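/- **Setting.** Let $(M,g_M)$ be a smooth Riemannian manifold with a hyperkähler structure $(I,J,K)$: smooth sections of $\mathrm{End}(TM)$ with $I^2=J^2=K^2=-\mathrm{id}$ and $IJ=-JI=K$, each orthogonal for $g_M$ and parallel for the Levi-Civita connection of $g_M$. Let $(N,g_N)$ be a smooth Riemannian manifold and $F:M\to N$ a horizontally conformal submersion with dilation $\lambda:M\to(0,\infty)$, that is, $F$ is smooth, every differential $(F_*)_p$ is surjective, and $g_N(F_*X,F_*Y)=\lambda(p)^2g_M(X,Y)$ for all $p\in M$ and $X,Y\in(\ker (F_*)_p)^\perp$. Assume that $F$ is an almost h-conformal slant submersion with almost h-conformal slant basis $(I,J,K)$: for each $R\in\{I,J,K\}$ the angle $\theta_R$ between $RX$ and $\ker(F_*)_p$ is the same for all $p\in M$ and all nonzero $X\in\ker(F_*)_p$. For $R\in\{I,J,K\}$ and a vertical vector $V\in\ker F_*$ let $\omega_RV$ be the component of $RV$ in $(\ker F_*)^\perp$, and let $\mu^R$ be the orthogonal complement of $\omega_R(\ker F_*)$ in $(\ker F_*)^\perp$. Let $(\nabla F_*)(X,Y)=\nabla^F_XF_*Y-F_*(\nabla_XY)$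 be the second fundamental form of $F$, where $\nabla$ is the Levi-Civita connection of $g_M$ and $\nabla^F$ is the pullback of that of $g_N$. The map $F$ is called $(\omega_R\ker F_*,\mu^R)$-totally geodesic if $(\nabla F_*)(\omega_RV,X)=0$ for all vertical $V$ and all $X$ in $\mu^R$. It is called horizontally homothetic if $X(\lambda)=0$ for every horizontal vector $X\in(\ker F_*)^\perp$. **Theorem 3.17.** If $F$ is horizontally homothetic, then $F$ is $(\omega_R\ker F_*,\mu^R)$-totally geodesic for every $R\in\{I,J,K\}$. Moreover, for each $R\in\{I,J,K\}$ such that neither of the distributions $\omega_R(\ker F_*)$ and $\mu^R$ is identically zero, the following are equivalent: 1. $F$ is horizontally homothetic; 2. $F$ is $(\omega_R\ker F_*,\mu^R)$-totally geodesic. In particular, if $\omega_R(\ker F_*)$ and $\mu^R$ are not identically zero for all three $R\in\{I,J,K\}$, then the following four conditions are equivalent: $F$ is horizontally homothetic; $F$ is $(\omega_I\ker F_*,\mu^I)$-totally geodesic; $F$ is $(\omega_J\ker F_*,\mu^J)$-totally geodesic; $F$ is $(\omega_K\ker F_*,\mu^K)$-totally geodesic. -/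

import Mathlib

open Bundle Manifold
open scoped ContDiff InnerProductSpace

noncomputable section

namespace SlantSubmersion

/-! Manifolds are modelled on a finite-dimensional real normed space without boundary. In Mathlib
the tangent space `TangentSpace 𝓘(ℝ, E) p` is the model space `E`, a tangent vector being identified
with its coordinates in the preferred chart `extChartAt 𝓘(ℝ, E) p` at `p`. -/

/-- For a field `G` of bilinear forms on `E`, the linear form
`w ↦ (∂_u G(v, w) + ∂_v G(u, w) - ∂_w G(u, v)) / 2` at the point `y`. -/
def koszulForm {E : Type*} [NormedAddCommGroup E] [NormedSpace ℝ E]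
    (G : E → E →L[ℝ] E →L[ℝ] ℝ) (y u v : E) : E →L[ℝ] ℝ :=
  (1 / 2 : ℝ) • (fderiv ℝ G y u v + fderiv ℝ G y v u - ((fderiv ℝ G y).flip u).flip v)

section Connection

variable {E : Type*} [NormedAddCommGroup E] [NormedSpace ℝ E] [FiniteDimensional ℝ E]
  {M : Type*} [TopologicalSpace M] [ChartedSpace E M]

instance finiteDimensionalTangentSpace (p : M) :
    FiniteDimensional ℝ (TangentSpace 𝓘(ℝ, E) p) :=
  inferInstanceAs (FiniteDimensional ℝ E)

variable [RiemannianBundle (fun p : M ↦ TangentSpace 𝓘(ℝ, E) p)]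

instance completeTangentSpace (p : M) : CompleteSpace (TangentSpace 𝓘(ℝ, E) p) :=
  FiniteDimensional.complete ℝ _

/-- The Riemannian metric in the preferred chart `φ` at `p`: the bilinear form
`g_y(v, w) = ⟨d(φ⁻¹)_y v, d(φ⁻¹)_y w⟩` on `E`, for `y` in the target of `φ`. -/
def chartMetric (p : M) (y : E) : E →L[ℝ] E →L[ℝ] ℝ :=
  let A : E →L[ℝ] TangentSpace 𝓘(ℝ, E) ((extChartAt 𝓘(ℝ, E) p).symm y) :=
    mfderiv 𝓘(ℝ, E) 𝓘(ℝ, E) (extChartAt 𝓘(ℝ, E) p).symm y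
  (innerSL ℝ (E := TangentSpace 𝓘(ℝ, E) ((extChartAt 𝓘(ℝ, E) p).symm y))).bilinearComp A A

/-- The Christoffel map of the Levi-Civita connection at `p` in the preferred chart at `p`
(in coordinates `u^i v^j Γ_{ij}^k`): `Γ(u, v)` is the vector with
`⟨Γ(u, v), w⟩ = (∂_u g(v, w) + ∂_v g(u, w) - ∂_w g(u, v)) / 2` for all `w`. -/
def christoffel (p : M) (u v : TangentSpace 𝓘(ℝ, E) p) : TangentSpace 𝓘(ℝ, E) p :=
  let k : TangentSpace 𝓘(ℝ, E) p →L[ℝ] ℝ :=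
    koszulForm (E := E) (chartMetric p) (extChartAt 𝓘(ℝ, E) p p) u v
  (InnerProductSpace.toDual ℝ (TangentSpace 𝓘(ℝ, E) p)).symm k

/-- The Levi-Civita covariant derivative `∇_u Y` at `p` of a vector field `Y` differentiable
at `p`: in the preferred chart at `p`, `∂_u Y + Γ(u, Y)`. -/
def leviCivita (Y : Π q : M, TangentSpace 𝓘(ℝ, E) q) (p : M) (u : TangentSpace 𝓘(ℝ, E) p) :
    TangentSpace 𝓘(ℝ, E) p :=
  let Ychart : M → E := fun q ↦ mfderiv 𝓘(ℝ, E) 𝓘(ℝ, E) (extChartAt 𝓘(ℝ, E) p) q (Y q)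
  let dY : TangentSpace 𝓘(ℝ, E) p := mfderiv 𝓘(ℝ, E) 𝓘(ℝ, E) Ychart p u
  dY + christoffel p u (Y p)

end Connection

section Maps

variable {E : Type*} [NormedAddCommGroup E] [NormedSpace ℝ E] [FiniteDimensional ℝ E]
  {M : Type*} [TopologicalSpace M] [ChartedSpace E M] [IsManifold 𝓘(ℝ, E) ∞ M]
  {E' : Type*} [NormedAddCommGroup E'] [NormedSpace ℝ E'] [FiniteDimensional ℝ E']
  {N : Type*} [TopologicalSpace N] [ChartedSpace E' N]
  [RiemannianBundle (fun q : N ↦ TangentSpace 𝓘(ℝ, E') q)]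

/-- The pullback `∇^F` of the Levi-Civita connection of `N` along `F : M → N`: the derivative
`∇^F_u W` at `p` of a section `W` of `F^* TN`, namely `∂_u W + Γ^N(F_* u, W)` in the preferred chart
of `N` at `F p`. -/
def pullbackCovDeriv (F : M → N) (W : Π q : M, TangentSpace 𝓘(ℝ, E') (F q)) (p : M)
    (u : TangentSpace 𝓘(ℝ, E) p) : TangentSpace 𝓘(ℝ, E') (F p) :=
  let Wchart : M → E' := fun q ↦
    mfderiv 𝓘(ℝ, E') 𝓘(ℝ, E') (extChartAt 𝓘(ℝ, E') (F p)) (F q) (W q)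
  let dW : TangentSpace 𝓘(ℝ, E') (F p) := mfderiv 𝓘(ℝ, E) 𝓘(ℝ, E') Wchart p u
  dW + christoffel (F p) (mfderiv 𝓘(ℝ, E) 𝓘(ℝ, E') F p u) (W p)

variable [RiemannianBundle (fun p : M ↦ TangentSpace 𝓘(ℝ, E) p)]

/-- The second fundamental form `(∇F_*)(u, v) = ∇^F_u (F_* Y) - F_* (∇_u Y)` of `F` at `p`, where
`Y` is a vector field, smooth near `p`, extending `v`. The value does not depend on the extension;
the one chosen here has constant coordinates in the preferred chart at `p`. -/
def secondFundamentalForm (F : M → N) (p : M) (u v : TangentSpace 𝓘(ℝ, E) p) :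
    TangentSpace 𝓘(ℝ, E') (F p) :=
  let Y : Π q : M, TangentSpace 𝓘(ℝ, E) q := FiberBundle.extend E v
  pullbackCovDeriv F (fun q ↦ mfderiv 𝓘(ℝ, E) 𝓘(ℝ, E') F q (Y q)) p u
    - mfderiv 𝓘(ℝ, E) 𝓘(ℝ, E') F p (leviCivita Y p u)

end Maps

section Hyperkaehler

variable {E : Type*} [NormedAddCommGroup E] [NormedSpace ℝ E] [FiniteDimensional ℝ E]
  {M : Type*} [TopologicalSpace M] [ChartedSpace E M] [IsManifold 𝓘(ℝ, E) ∞ M]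
  [RiemannianBundle (fun p : M ↦ TangentSpace 𝓘(ℝ, E) p)]

/-- `(I, J, K)` together with the Riemannian metric of `M` is a hyperkähler structure: smooth
sections of `End(TM)` with `I² = J² = K² = -id` and `IJ = -JI = K`, orthogonal for the metric and
parallel for the Levi-Civita connection. -/
structure IsHyperkaehler
    (I J K : Π p : M, TangentSpace 𝓘(ℝ, E) p →L[ℝ] TangentSpace 𝓘(ℝ, E) p) : Prop where
  smooth : ∀ R ∈ ({I, J, K} : Set _),
    ContMDiff 𝓘(ℝ, E) (𝓘(ℝ, E).prod 𝓘(ℝ, E →L[ℝ] E)) ∞ (fun p ↦ TotalSpace.mk' (E →L[ℝ] E)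
      (E := fun p : M ↦ TangentSpace 𝓘(ℝ, E) p →L[ℝ] TangentSpace 𝓘(ℝ, E) p) p (R p))
  sq : ∀ R ∈ ({I, J, K} : Set _), ∀ p, ∀ v : TangentSpace 𝓘(ℝ, E) p, R p (R p v) = -v
  mul_eq : ∀ p, ∀ v : TangentSpace 𝓘(ℝ, E) p, I p (J p v) = K p v
  mul_eq_neg : ∀ p, ∀ v : TangentSpace 𝓘(ℝ, E) p, J p (I p v) = -K p v
  inner_eq : ∀ R ∈ ({I, J, K} : Set _), ∀ p, ∀ v w : TangentSpace 𝓘(ℝ, E) p,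
    ⟪R p v, R p w⟫_ℝ = ⟪v, w⟫_ℝ
  parallel : ∀ R ∈ ({I, J, K} : Set _), ∀ p, ∀ Y : Π q : M, TangentSpace 𝓘(ℝ, E) q,
    ContMDiffAt 𝓘(ℝ, E) 𝓘(ℝ, E).tangent ∞ (fun q ↦ (⟨q, Y q⟩ : TangentBundle 𝓘(ℝ, E) M)) p →
    ∀ u : TangentSpace 𝓘(ℝ, E) p,
      leviCivita (fun q ↦ R q (Y q)) p u = R p (leviCivita Y p u)

end Hyperkaehler

section Submersions

variable {E : Type*} [NormedAddCommGroup E] [NormedSpace ℝ E] [FiniteDimensional ℝ E]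
  {M : Type*} [TopologicalSpace M] [ChartedSpace E M] [IsManifold 𝓘(ℝ, E) ∞ M]
  {E' : Type*} [NormedAddCommGroup E'] [NormedSpace ℝ E']
  {N : Type*} [TopologicalSpace N] [ChartedSpace E' N]

/-- The vertical space `ker (F_*)_p`. -/
def vert (F : M → N) (p : M) : Submodule ℝ (TangentSpace 𝓘(ℝ, E) p) :=
  (mfderiv 𝓘(ℝ, E) 𝓘(ℝ, E') F p).ker

variable [RiemannianBundle (fun p : M ↦ TangentSpace 𝓘(ℝ, E) p)]

/-- The horizontal space `(ker (F_*)_p)^⊥`. -/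
def horiz (F : M → N) (p : M) : Submodule ℝ (TangentSpace 𝓘(ℝ, E) p) :=
  (vert (E' := E') F p)ᗮ

/-- `F` is a (smooth) horizontally conformal submersion with dilation `lam`. -/
structure IsHorizontallyConformalSubmersion [FiniteDimensional ℝ E']
    [RiemannianBundle (fun q : N ↦ TangentSpace 𝓘(ℝ, E') q)]
    (F : M → N) (lam : M → ℝ) : Prop where
  smooth : ContMDiff 𝓘(ℝ, E) 𝓘(ℝ, E') ∞ F
  surjective : ∀ p, Function.Surjective (mfderiv 𝓘(ℝ, E) 𝓘(ℝ, E') F p)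
  pos : ∀ p, 0 < lam p
  inner_eq : ∀ p, ∀ x ∈ horiz (E' := E') F p, ∀ y ∈ horiz (E' := E') F p,
    ⟪mfderiv 𝓘(ℝ, E) 𝓘(ℝ, E') F p x, mfderiv 𝓘(ℝ, E) 𝓘(ℝ, E') F p y⟫_ℝ
      = lam p ^ 2 * ⟪x, y⟫_ℝ

/-- The submersion `F` with dilation `lam` is horizontally homothetic: the gradient of `lam` is
vertical, that is, `X(lam) = 0` for every horizontal vector `X`. -/
def IsHorizontallyHomothetic (F : M → N) (lam : M → ℝ) : Prop :=
  ∀ p, ∀ x ∈ horiz (E' := E') F p, mfderiv 𝓘(ℝ, E) 𝓘(ℝ, ℝ) lam p x = 0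

/-- The angle in `[0, π/2]` between a nonzero vector `x` and a subspace `W`, whose cosine is the
ratio of the norm of the orthogonal projection of `x` to `W` and the norm of `x`. -/
def angleToSubspace {V : Type*} [NormedAddCommGroup V] [InnerProductSpace ℝ V]
    (x : V) (W : Submodule ℝ V) [W.HasOrthogonalProjection] : ℝ :=
  Real.arccos (‖W.starProjection x‖ / ‖x‖)

/-- `(I, J, K)` is an almost h-conformal slant basis for `F`: for each `R` among `I, J, K` the angle
between `R X` and the vertical space is the same for all nonzero vertical vectors `X` at all
points. -/
def IsAlmostHConformalSlantBasis (F : M → N)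
    (I J K : Π p : M, TangentSpace 𝓘(ℝ, E) p →L[ℝ] TangentSpace 𝓘(ℝ, E) p) : Prop :=
  ∀ R ∈ ({I, J, K} : Set _), ∃ θ : ℝ, ∀ p, ∀ x ∈ vert (E' := E') F p, x ≠ 0 →
    angleToSubspace (R p x) (vert (E' := E') F p) = θ

/-- The map `ω_R`: the horizontal part of `R V`. -/
def omega (F : M → N) (R : Π p : M, TangentSpace 𝓘(ℝ, E) p →L[ℝ] TangentSpace 𝓘(ℝ, E) p)
    (p : M) : TangentSpace 𝓘(ℝ, E) p →L[ℝ] TangentSpace 𝓘(ℝ, E) p :=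
  (vert (E' := E') F p)ᗮ.starProjection ∘L R p

/-- The subspace `ω_R (ker F_*)` of the horizontal space. -/
def omegaVert (F : M → N) (R : Π p : M, TangentSpace 𝓘(ℝ, E) p →L[ℝ] TangentSpace 𝓘(ℝ, E) p)
    (p : M) : Submodule ℝ (TangentSpace 𝓘(ℝ, E) p) :=
  (vert (E' := E') F p).map (omega (E' := E') F R p).toLinearMap

/-- The orthogonal complement `μ^R` of `ω_R (ker F_*)` in the horizontal space. -/
def mu (F : M → N) (R : Π p : M, TangentSpace 𝓘(ℝ, E) p →L[ℝ] TangentSpace 𝓘(ℝ, E) p)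
    (p : M) : Submodule ℝ (TangentSpace 𝓘(ℝ, E) p) :=
  horiz (E' := E') F p ⊓ (omegaVert (E' := E') F R p)ᗮ

/-- `F` is `(ω_R ker F_*, μ^R)`-totally geodesic: `(∇F_*)(ω_R V, X) = 0` for vertical `V` and for
`X` in `μ^R` (a pointwise condition, since `∇F_*` is a tensor). -/
def IsOmegaMuTotallyGeodesic [FiniteDimensional ℝ E']
    [RiemannianBundle (fun q : N ↦ TangentSpace 𝓘(ℝ, E') q)]
    (F : M → N) (R : Π p : M, TangentSpace 𝓘(ℝ, E) p →L[ℝ] TangentSpace 𝓘(ℝ, E) p) : Prop :=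
  ∀ p, ∀ v ∈ vert (E' := E') F p, ∀ x ∈ mu (E' := E') F R p,
    secondFundamentalForm (E' := E') F p (omega (E' := E') F R p v) x = 0

end Submersions

end SlantSubmersion

end

open scoped Topology

/-! Everything rests on one identity for horizontal `x`, `y`, `z`, proved in
`inner_secondFundamentalForm`: `⟨(∇F_*)(x, y), F_* z⟩ = λ (dλ(x)⟨y, z⟩ + dλ(y)⟨x, z⟩ - dλ(z)⟨x,
y⟩)`. If `dλ` vanishes on horizontal vectors, so does the right side, and surjectivity of `F_*`
gives `(∇F_*)(x, y) = 0`. Conversely, take `x` in `ω_R (ker F_*)` and `y` in `μ^R`, which are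
orthogonal: `z = y` isolates `dλ(x)‖y‖²` and `z = x` isolates `dλ(y)‖x‖²`. When both spaces are
nonzero at a point, `dλ` kills each of them, hence their sum, the horizontal space. Nonvanishing at
one point suffices because the slant angle is constant: if it is nonzero, `ω_R` is injective on
every vertical space, so both distributions have constant rank (`finrank_omegaVert`).

The identity is proved in charts. Horizontal conformality is rewritten as `T T* = λ²` for `T = F_*`,
a condition on all covectors that needs no horizontal projection and can be differentiated at once.
Differentiating it along adjoint fields and permuting the three arguments as in Koszul's formula
makes the Christoffel terms of both metrics appear (`koszulForm_horizontallyConformal`). -/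

namespace SlantSubmersion

set_option synthInstance.maxHeartbeats 200000

/-! ### Conformality and the Koszul permutation for metrics on vector spaces. -/

section Coordinates

variable {E : Type*} [NormedAddCommGroup E] [NormedSpace ℝ E] [FiniteDimensional ℝ E]
  {E' : Type*} [NormedAddCommGroup E'] [NormedSpace ℝ E']

theorem koszulForm_apply {V : Type*} [NormedAddCommGroup V] [NormedSpace ℝ V]
    (G : V → V →L[ℝ] V →L[ℝ] ℝ) (y u v w : V) :
    koszulForm G y u v w
      = 1 / 2 * (fderiv ℝ G y u v w + fderiv ℝ G y v u w - fderiv ℝ G y w u v) :=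
  rfl

/-- The field is `P = G⁻¹ (f'ᵗ H a)`, the adjoint of `f'` applied to the constant vector `a`. It is
differentiable because operator inversion is smooth at invertible operators and `f` is `C²`. It
serves as a local horizontal extension of a horizontal vector. -/
theorem exists_adjoint_field {G : E → E →L[ℝ] E →L[ℝ] ℝ} {H : E' → E' →L[ℝ] E' →L[ℝ] ℝ}
    {f : E → E'} {y₀ : E} (hG : DifferentiableAt ℝ G y₀) (hH : DifferentiableAt ℝ H (f y₀))
    (hf : ContDiffAt ℝ 2 f y₀) (hinv : (G y₀).IsInvertible) (a : E') :
    ∃ P : E → E, DifferentiableAt ℝ P y₀ ∧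
      ∀ᶠ y in 𝓝 y₀, ∀ w, G y (P y) w = H (f y) a (fderiv ℝ f y w) := by
  have : CompleteSpace E := FiniteDimensional.complete ℝ E
  have hfd : DifferentiableAt ℝ f y₀ := hf.differentiableAt (by norm_num)
  have hDf : DifferentiableAt ℝ (fderiv ℝ f) y₀ :=
    (hf.fderiv_right (m := 1) (by norm_num)).differentiableAt (by norm_num)
  have hHf : DifferentiableAt ℝ (fun y ↦ H (f y)) y₀ :=
    DifferentiableAt.comp (G := E' →L[ℝ] E' →L[ℝ] ℝ) (g := H) y₀ hH hfd
  refine ⟨fun y ↦ (G y).inverse ((H (f y) a).comp (fderiv ℝ f y)), ?_, ?_⟩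
  · have h1 : DifferentiableAt ℝ (fun y ↦ (G y).inverse) y₀ :=
      ((hinv.contDiffAt_map_inverse (n := 1)).differentiableAt (by norm_num)).comp y₀ hG
    exact h1.clm_apply ((hHf.clm_apply (differentiableAt_const a)).clm_comp hDf)
  -- `inverse` takes the default value zero at non-invertible operators; invertibility is an open
  -- condition, so the relation holds near `y₀`.
  · obtain ⟨e, he⟩ := hinv
    have hev : ∀ᶠ y in 𝓝 y₀, G y ∈ Set.range ((↑) : (E ≃L[ℝ] E →L[ℝ] ℝ) → _) :=
      hG.continuousAt.eventually_mem (he ▸ e.nhds)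
    filter_upwards [hev] with y hy w
    obtain ⟨e', he'⟩ := hy
    rw [← he']
    simp

/-- The derivative, in the direction `z`, of the conformality relation between the metrics `G` and
`H` along a horizontal field through `x`. -/
theorem fderiv_horizontallyConformal {G : E → E →L[ℝ] E →L[ℝ] ℝ}
    {H : E' → E' →L[ℝ] E' →L[ℝ] ℝ} {f : E → E'} {L : E → ℝ} {y₀ : E}
    (hG : DifferentiableAt ℝ G y₀) (hH : DifferentiableAt ℝ H (f y₀))
    (hf : ContDiffAt ℝ 2 f y₀) (hL : DifferentiableAt ℝ L y₀) (hinv : (G y₀).IsInvertible)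
    (hGs : ∀ v w, G y₀ v w = G y₀ w v) (hHs : ∀ v w, H (f y₀) v w = H (f y₀) w v)
    (hconf : ∀ᶠ y in 𝓝 y₀, ∀ z a, (∀ w, G y z w = H (f y) a (fderiv ℝ f y w)) →
      fderiv ℝ f y z = L y • a)
    {x y z : E} {a b : E'}
    (hx : ∀ w, G y₀ x w = H (f y₀) a (fderiv ℝ f y₀ w))
    (hy : ∀ w, G y₀ y w = H (f y₀) b (fderiv ℝ f y₀ w)) :
    H (f y₀) (fderiv ℝ (fderiv ℝ f) y₀ z x) b + H (f y₀) (fderiv ℝ (fderiv ℝ f) y₀ z y) a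
      = fderiv ℝ G y₀ z x y + fderiv ℝ L y₀ z * H (f y₀) a b
        - L y₀ * fderiv ℝ H (f y₀) (fderiv ℝ f y₀ z) a b := by
  have hfd : DifferentiableAt ℝ f y₀ := hf.differentiableAt (by norm_num)
  have hDf : DifferentiableAt ℝ (fderiv ℝ f) y₀ :=
    (hf.fderiv_right (m := 1) (by norm_num)).differentiableAt (by norm_num)
  have hHf : HasFDerivAt (fun y ↦ H (f y)) ((fderiv ℝ H (f y₀)).comp (fderiv ℝ f y₀)) y₀ :=
    HasFDerivAt.comp (G := E' →L[ℝ] E' →L[ℝ] ℝ) (g := H) y₀ hH.hasFDerivAt hfd.hasFDerivAt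
  have hinj : Function.Injective (G y₀) := by
    obtain ⟨e, he⟩ := hinv
    rw [← he]; exact e.injective
  obtain ⟨P, hP, hPe⟩ := exists_adjoint_field hG hH hf hinv a
  have hP0 : P y₀ = x := hinj (by ext w; rw [hPe.self_of_nhds w, hx w])
  -- Two relations satisfied by `P` are differentiated in the direction `z`: `f' P = L a`, and the
  -- adjoint relation tested on the constant vector `y`.
  have hconf' : (fun u ↦ fderiv ℝ f u (P u)) =ᶠ[𝓝 y₀] fun u ↦ L u • a := by
    filter_upwards [hconf, hPe] with u h1 h2 using h1 _ _ h2
  have d1 := (hDf.hasFDerivAt.clm_apply hP.hasFDerivAt).congr_of_eventuallyEq hconf'.symm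
  have e1 := congrArg (fun T ↦ T z) (d1.unique (hL.hasFDerivAt.smul_const a))
  have hmet : (fun u ↦ G u (P u) y) =ᶠ[𝓝 y₀] fun u ↦ H (f u) a (fderiv ℝ f u y) := by
    filter_upwards [hPe] with u h using h y
  have d2 := ((hG.hasFDerivAt.clm_apply hP.hasFDerivAt).clm_apply
    (hasFDerivAt_const y y₀)).congr_of_eventuallyEq hmet.symm
  have d3 := (hHf.clm_apply (hasFDerivAt_const a y₀)).clm_apply
    (hDf.hasFDerivAt.clm_apply (hasFDerivAt_const y y₀))
  have e2 := congrArg (fun T ↦ T z) (d2.unique d3)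
  have hyc := hconf.self_of_nhds y b hy
  simp [hP0] at e1 e2
  -- The unknown derivative of `P` enters `e2` only through `G (P' z) y`. By `hy` this equals `H b
  -- (f' (P' z))`, and `e1` expresses `f' (P' z)` through `L'` and the second derivative of `f`.
  have e3 := hy (fderiv ℝ P y₀ z)
  rw [eq_sub_of_add_eq e1] at e3
  rw [hGs, e3, hyc] at e2
  simp at e2
  linear_combination -e2 + fderiv ℝ L y₀ z * hHs b a + hHs (fderiv ℝ (fderiv ℝ f) y₀ z x) b
    + hHs (fderiv ℝ (fderiv ℝ f) y₀ z y) a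

/-- The Koszul permutation argument for horizontally conformal maps, in coordinates. -/
theorem koszulForm_horizontallyConformal {G : E → E →L[ℝ] E →L[ℝ] ℝ}
    {H : E' → E' →L[ℝ] E' →L[ℝ] ℝ} {f : E → E'} {L : E → ℝ} {y₀ : E}
    (hG : DifferentiableAt ℝ G y₀) (hH : DifferentiableAt ℝ H (f y₀))
    (hf : ContDiffAt ℝ 2 f y₀) (hL : DifferentiableAt ℝ L y₀) (hinv : (G y₀).IsInvertible)
    (hGs : ∀ v w, G y₀ v w = G y₀ w v) (hHs : ∀ v w, H (f y₀) v w = H (f y₀) w v)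
    (hconf : ∀ᶠ y in 𝓝 y₀, ∀ z a, (∀ w, G y z w = H (f y) a (fderiv ℝ f y w)) →
      fderiv ℝ f y z = L y • a)
    {x y z : E} {a b c : E'}
    (hx : ∀ w, G y₀ x w = H (f y₀) a (fderiv ℝ f y₀ w))
    (hy : ∀ w, G y₀ y w = H (f y₀) b (fderiv ℝ f y₀ w))
    (hz : ∀ w, G y₀ z w = H (f y₀) c (fderiv ℝ f y₀ w)) :
    H (f y₀) (fderiv ℝ (fderiv ℝ f) y₀ x y) c
        + koszulForm H (f y₀) (fderiv ℝ f y₀ x) (fderiv ℝ f y₀ y) c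
        - koszulForm G y₀ x y z
      = (fderiv ℝ L y₀ x * H (f y₀) b c + fderiv ℝ L y₀ y * H (f y₀) a c
        - fderiv ℝ L y₀ z * H (f y₀) a b) / 2 := by
  have hsymm : ∀ u v, fderiv ℝ (fderiv ℝ f) y₀ u v = fderiv ℝ (fderiv ℝ f) y₀ v u :=
    fun u v ↦ (hf.isSymmSndFDerivAt (by simp)) u v
  have k1 := fderiv_horizontallyConformal hG hH hf hL hinv hGs hHs hconf hy hz (z := x)
  have k2 := fderiv_horizontallyConformal hG hH hf hL hinv hGs hHs hconf hx hz (z := y)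
  have k3 := fderiv_horizontallyConformal hG hH hf hL hinv hGs hHs hconf hx hy (z := z)
  rw [hsymm z x, hsymm z y] at k3
  rw [hsymm y x] at k2
  have hxc := hconf.self_of_nhds x a hx
  have hyc := hconf.self_of_nhds y b hy
  have hzc := hconf.self_of_nhds z c hz
  rw [hxc] at k1
  rw [hyc] at k2
  rw [hzc] at k3
  rw [hxc, hyc]
  simp only [map_smul, smul_apply, smul_eq_mul] at k1 k2 k3
  simp only [koszulForm_apply, map_smul, smul_apply, smul_eq_mul]
  -- By symmetry of the second derivative, the terms in `(x, z)` and `(y, z)` cancel and the term in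
  -- `(x, y)` is doubled.
  linear_combination (k1 + k2 - k3) / 2

end Coordinates

/-! ### Finite-dimensional criteria for differentiability and invertibility. -/

section FiniteDimension

theorem differentiableAt_of_apply {D E F : Type*} [NormedAddCommGroup D] [NormedSpace ℝ D]
    [NormedAddCommGroup E] [NormedSpace ℝ E] [FiniteDimensional ℝ E]
    [NormedAddCommGroup F] [NormedSpace ℝ F] {f : D → E →L[ℝ] F} {x : D}
    (h : ∀ v, DifferentiableAt ℝ (fun y ↦ f y v) x) : DifferentiableAt ℝ f x := by
  have hd : Module.finrank ℝ E = Module.finrank ℝ (Fin (Module.finrank ℝ E) → ℝ) :=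
    (Module.finrank_fin_fun ℝ).symm
  let e₁ := ContinuousLinearEquiv.ofFinrankEq hd
  let e₂ := (e₁.arrowCongr (1 : F ≃L[ℝ] F)).trans (ContinuousLinearEquiv.piRing _)
  rw [← Function.id_comp f, ← e₂.symm_comp_self]
  exact e₂.symm.differentiableAt.comp x (differentiableAt_pi.mpr fun i ↦ h _)

theorem isInvertible_of_injective {V : Type*} [NormedAddCommGroup V] [NormedSpace ℝ V]
    [FiniteDimensional ℝ V] (T : V →L[ℝ] V →L[ℝ] ℝ) (hT : Function.Injective T) :
    T.IsInvertible := by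
  have hd : Module.finrank ℝ V = Module.finrank ℝ (V →L[ℝ] ℝ) := by
    rw [← (LinearMap.toContinuousLinearMap (𝕜 := ℝ) (E := V) (F' := ℝ)).finrank_eq]
    exact (Subspace.dual_finrank_eq (K := ℝ) (V := V)).symm
  have : FiniteDimensional ℝ (V →L[ℝ] ℝ) :=
    (LinearMap.toContinuousLinearMap (𝕜 := ℝ) (E := V) (F' := ℝ)).finiteDimensional
  exact ⟨(LinearEquiv.ofInjectiveOfFinrankEq (T : V →ₗ[ℝ] V →L[ℝ] ℝ) hT hd).toContinuousLinearEquiv,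
    by ext; rfl⟩

end FiniteDimension

/-! ### Chart differentials, the chart metric and constant-coordinate extensions. -/

section Charts

variable {E : Type*} [NormedAddCommGroup E] [NormedSpace ℝ E]
  {M : Type*} [TopologicalSpace M] [ChartedSpace E M] [IsManifold 𝓘(ℝ, E) ∞ M]

theorem isInvertible_mfderiv_extChartAt_symm {p : M} {y : E}
    (hy : y ∈ (extChartAt 𝓘(ℝ, E) p).target) :
    (mfderiv 𝓘(ℝ, E) 𝓘(ℝ, E) (extChartAt 𝓘(ℝ, E) p).symm y).IsInvertible := by
  have : IsManifold 𝓘(ℝ, E) 1 M := IsManifold.of_le (n := ∞) (by simp)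
  have h := isInvertible_mfderivWithin_extChartAt_symm (I := 𝓘(ℝ, E)) hy
  rwa [ModelWithCorners.range_eq_univ, mfderivWithin_univ] at h

theorem mdifferentiableAt_extChartAt_symm {p : M} {y : E}
    (hy : y ∈ (extChartAt 𝓘(ℝ, E) p).target) :
    MDifferentiableAt 𝓘(ℝ, E) 𝓘(ℝ, E) (extChartAt 𝓘(ℝ, E) p).symm y := by
  have : IsManifold 𝓘(ℝ, E) 1 M := IsManifold.of_le (n := ∞) (by simp)
  have h := mdifferentiableWithinAt_extChartAt_symm (I := 𝓘(ℝ, E)) hy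
  rwa [ModelWithCorners.range_eq_univ, mdifferentiableWithinAt_univ] at h

theorem mfderiv_extChartAt_symm_self (p : M) (v : E) :
    mfderiv 𝓘(ℝ, E) 𝓘(ℝ, E) (extChartAt 𝓘(ℝ, E) p).symm (extChartAt 𝓘(ℝ, E) p p) v = v := by
  have : IsManifold 𝓘(ℝ, E) 1 M := IsManifold.of_le (n := ∞) (by simp)
  have h := mfderivWithin_range_extChartAt_symm (I := 𝓘(ℝ, E)) (x := p)
  rw [ModelWithCorners.range_eq_univ, mfderivWithin_univ] at h
  rw [h]
  rfl

section Differentiability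

variable [RiemannianBundle (fun p : M ↦ TangentSpace 𝓘(ℝ, E) p)]

omit [IsManifold 𝓘(ℝ, E) ∞ M] in
theorem chartMetric_apply [FiniteDimensional ℝ E] (p : M) (y v w : E) :
    chartMetric p y v w =
      inner ℝ (E := TangentSpace 𝓘(ℝ, E) ((extChartAt 𝓘(ℝ, E) p).symm y))
        (mfderiv 𝓘(ℝ, E) 𝓘(ℝ, E) (extChartAt 𝓘(ℝ, E) p).symm y v)
        (mfderiv 𝓘(ℝ, E) 𝓘(ℝ, E) (extChartAt 𝓘(ℝ, E) p).symm y w) :=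
  rfl

-- All tangent spaces are `E` by definition, so only the inner product depends on the base point
-- when a point is replaced by an equal one.
omit [IsManifold 𝓘(ℝ, E) ∞ M] in
theorem inner_congr_point {p q : M} (h : q = p) (v w : E) :
    inner ℝ (E := TangentSpace 𝓘(ℝ, E) q) v w = inner ℝ (E := TangentSpace 𝓘(ℝ, E) p) v w := by
  subst h; rfl

theorem chartMetric_self [FiniteDimensional ℝ E] (p : M) (v w : E) :
    chartMetric p (extChartAt 𝓘(ℝ, E) p p) v w
      = inner ℝ (E := TangentSpace 𝓘(ℝ, E) p) v w := by
  rw [chartMetric_apply, mfderiv_extChartAt_symm_self, mfderiv_extChartAt_symm_self]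
  exact inner_congr_point (extChartAt_to_inv p) v w

theorem differentiableAt_chartMetric [FiniteDimensional ℝ E]
    [IsContMDiffRiemannianBundle 𝓘(ℝ, E) ∞ E (fun p : M ↦ TangentSpace 𝓘(ℝ, E) p)] (p : M) :
    DifferentiableAt ℝ (chartMetric p) (extChartAt 𝓘(ℝ, E) p p) := by
  have : IsManifold 𝓘(ℝ, E) 1 M := IsManifold.of_le (n := ∞) (by simp)
  set φ := extChartAt 𝓘(ℝ, E) p
  have hopen : IsOpen φ.target := isOpen_extChartAt_target p
  have hmem : φ p ∈ φ.target := mem_extChartAt_target p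
  -- The coordinate field of `v` is the tangent map of `φ⁻¹` composed with the constant section `y ↦
  -- (y, v)`. Inner products of two such fields are the entries of the chart metric.
  have hA : ∀ v : E, ContMDiffAt 𝓘(ℝ, E) 𝓘(ℝ, E).tangent 1
      (fun y ↦ (⟨φ.symm y, mfderiv 𝓘(ℝ, E) 𝓘(ℝ, E) φ.symm y v⟩ :
        TangentBundle 𝓘(ℝ, E) M)) (φ p) := by
    intro v
    have h1 := (contMDiffOn_extChartAt_symm (I := 𝓘(ℝ, E)) (n := 2) p).contMDiffOn_tangentMapWithin
      (m := 1) (by norm_num) hopen.uniqueMDiffOn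
    have h2 : ContMDiff 𝓘(ℝ, E) 𝓘(ℝ, E).tangent 1
        (fun y ↦ (⟨y, v⟩ : TangentBundle 𝓘(ℝ, E) E)) :=
      contMDiff_vectorSpace_iff_contDiff.2 contDiff_const
    have h3 := (h1.comp h2.contMDiffOn (s := φ.target) (fun y hy ↦ hy)).contMDiffAt
      (hopen.mem_nhds hmem)
    refine h3.congr_of_eventuallyEq ?_
    filter_upwards [hopen.mem_nhds hmem] with y hy
    simp only [Function.comp_apply, tangentMapWithin, mfderivWithin_of_isOpen hopen hy, φ]
  have hentry : ∀ v w, DifferentiableAt ℝ (fun y ↦ chartMetric p y v w) (φ p) := by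
    intro v w
    have : IsContMDiffRiemannianBundle 𝓘(ℝ, E) 1 E (fun p : M ↦ TangentSpace 𝓘(ℝ, E) p) :=
      IsContMDiffRiemannianBundle.of_le (n := ∞) (by simp)
    have h := ContMDiffAt.inner_bundle (IB := 𝓘(ℝ, E)) (E := fun p : M ↦ TangentSpace 𝓘(ℝ, E) p)
      (hA v) (hA w)
    exact h.contDiffAt.differentiableAt (by simp)
  exact differentiableAt_of_apply fun v ↦ differentiableAt_of_apply fun w ↦ hentry v w

omit [IsManifold 𝓘(ℝ, E) ∞ M] in
theorem chartMetric_comm [FiniteDimensional ℝ E] (p : M) (y v w : E) :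
    chartMetric p y v w = chartMetric p y w v := by
  rw [chartMetric_apply, chartMetric_apply, real_inner_comm]

theorem isInvertible_chartMetric_self [FiniteDimensional ℝ E] (p : M) :
    (chartMetric p (extChartAt 𝓘(ℝ, E) p p)).IsInvertible := by
  have hinj : Function.Injective (chartMetric p (extChartAt 𝓘(ℝ, E) p p)) := by
    rw [injective_iff_map_eq_zero]
    intro v hv
    have h := chartMetric_self p v v
    rw [hv] at h
    exact (inner_self_eq_zero (𝕜 := ℝ) (E := TangentSpace 𝓘(ℝ, E) p)).1 h.symm
  exact isInvertible_of_injective _ hinj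

end Differentiability

section Derivatives

theorem hasMFDerivAt_of_eventuallyEq_comp_extChartAt {V : Type*} [NormedAddCommGroup V]
    [NormedSpace ℝ V] {W : M → V} {g : E → V} {p : M}
    (hg : DifferentiableAt ℝ g (extChartAt 𝓘(ℝ, E) p p))
    (h : W =ᶠ[𝓝 p] fun q ↦ g (extChartAt 𝓘(ℝ, E) p q)) :
    HasMFDerivAt 𝓘(ℝ, E) 𝓘(ℝ, V) W p (fderiv ℝ g (extChartAt 𝓘(ℝ, E) p p)) := by
  have : IsManifold 𝓘(ℝ, E) 1 M := IsManifold.of_le (n := ∞) (by norm_num)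
  have h1 := (mdifferentiableAt_extChartAt (I := 𝓘(ℝ, E)) (mem_chart_source E p)).hasMFDerivAt
  rw [mfderiv_extChartAt_self] at h1
  exact (hg.hasFDerivAt.hasMFDerivAt.comp p h1).congr_of_eventuallyEq h

theorem mfderiv_apply_of_eventuallyEq_comp_extChartAt {V : Type*} [NormedAddCommGroup V]
    [NormedSpace ℝ V] {W : M → V} {g : E → V} {p : M}
    (hg : DifferentiableAt ℝ g (extChartAt 𝓘(ℝ, E) p p))
    (h : W =ᶠ[𝓝 p] fun q ↦ g (extChartAt 𝓘(ℝ, E) p q)) (u : TangentSpace 𝓘(ℝ, E) p) :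
    (mfderiv 𝓘(ℝ, E) 𝓘(ℝ, V) W p u : V) = fderiv ℝ g (extChartAt 𝓘(ℝ, E) p p) u :=
  congrArg (fun T ↦ T u) (hasMFDerivAt_of_eventuallyEq_comp_extChartAt hg h).mfderiv

end Derivatives

section Extension

theorem extend_eq_mfderiv_symm {p q : M} (hq : q ∈ (extChartAt 𝓘(ℝ, E) p).source)
    (v : TangentSpace 𝓘(ℝ, E) p) :
    (FiberBundle.extend E v q : E) =
      mfderiv 𝓘(ℝ, E) 𝓘(ℝ, E) (extChartAt 𝓘(ℝ, E) p).symm (extChartAt 𝓘(ℝ, E) p q) v := by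
  have : IsManifold 𝓘(ℝ, E) 1 M := IsManifold.of_le (n := ∞) (by norm_num)
  rw [extChartAt_source] at hq
  have h1 := TangentBundle.symmL_trivializationAt (I := 𝓘(ℝ, E)) hq
  rw [ModelWithCorners.range_eq_univ, mfderivWithin_univ] at h1
  have h2 := TangentBundle.continuousLinearMapAt_trivializationAt (I := 𝓘(ℝ, E))
    (mem_chart_source E p)
  rw [mfderiv_extChartAt_self] at h2
  have h3 : (trivializationAt E (TangentSpace 𝓘(ℝ, E)) p ⟨p, v⟩).2 = v := by
    have h4 := congrArg (fun T ↦ T v) h2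
    rw [← Trivialization.continuousLinearMapAt_apply_of_mem (R := ℝ) _
      (FiberBundle.mem_baseSet_trivializationAt' p)]
    exact h4
  rw [← h1]
  simp only [FiberBundle.extend, h3]
  exact (Trivialization.symmL_apply _ (by simpa using hq) _).symm

theorem mfderiv_extChartAt_comp_symm {p : M} {y : E} (hy : y ∈ (extChartAt 𝓘(ℝ, E) p).target)
    (v : E) :
    mfderiv 𝓘(ℝ, E) 𝓘(ℝ, E) (extChartAt 𝓘(ℝ, E) p) ((extChartAt 𝓘(ℝ, E) p).symm y)
      (mfderiv 𝓘(ℝ, E) 𝓘(ℝ, E) (extChartAt 𝓘(ℝ, E) p).symm y v) = v := by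
  have : IsManifold 𝓘(ℝ, E) 1 M := IsManifold.of_le (n := ∞) (by norm_num)
  have h := mfderiv_extChartAt_comp_mfderivWithin_extChartAt_symm (I := 𝓘(ℝ, E)) hy
  rw [ModelWithCorners.range_eq_univ, mfderivWithin_univ] at h
  exact congrArg (fun T ↦ T v) h

/-- The extension has constant coordinates in the chart at `p`, so the term `∂_u Y` vanishes. -/
theorem leviCivita_extend [FiniteDimensional ℝ E]
    [RiemannianBundle (fun p : M ↦ TangentSpace 𝓘(ℝ, E) p)] (p : M)
    (u v : TangentSpace 𝓘(ℝ, E) p) :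
    leviCivita (FiberBundle.extend E v) p u = christoffel p u v := by
  have h : (fun q ↦ mfderiv 𝓘(ℝ, E) 𝓘(ℝ, E) (extChartAt 𝓘(ℝ, E) p) q
      (FiberBundle.extend E v q) : M → E) =ᶠ[𝓝 p] fun _ ↦ v := by
    filter_upwards [extChartAt_source_mem_nhds (I := 𝓘(ℝ, E)) p] with q hq
    have h1 := mfderiv_extChartAt_comp_symm ((extChartAt 𝓘(ℝ, E) p).map_source hq) v
    rw [(extChartAt 𝓘(ℝ, E) p).left_inv hq] at h1
    exact (congrArg (mfderiv 𝓘(ℝ, E) 𝓘(ℝ, E) (extChartAt 𝓘(ℝ, E) p) q)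
      (extend_eq_mfderiv_symm hq v)).trans h1
  have h0 := mfderiv_apply_of_eventuallyEq_comp_extChartAt
    (g := fun _ ↦ (v : E)) (differentiableAt_const _) h u
  rw [fderiv_const_apply] at h0
  simp only [leviCivita, FiberBundle.extend_apply_self]
  exact (congrArg (fun e : TangentSpace 𝓘(ℝ, E) p ↦ e + christoffel p u v) h0).trans (zero_add _)

end Extension

end Charts

/-! ### The map and its second fundamental form in coordinates. -/

section ChartMap

theorem hasFDerivAt_fderiv_apply {V W : Type*} [NormedAddCommGroup V] [NormedSpace ℝ V]
    [NormedAddCommGroup W] [NormedSpace ℝ W] {f : V → W} {y : V}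
    (h : DifferentiableAt ℝ (fderiv ℝ f) y) (v : V) :
    HasFDerivAt (fun z ↦ fderiv ℝ f z v) ((fderiv ℝ (fderiv ℝ f) y).flip v) y := by
  have := h.hasFDerivAt.clm_apply (hasFDerivAt_const v y)
  rwa [ContinuousLinearMap.comp_zero, zero_add] at this

variable {E : Type*} [NormedAddCommGroup E] [NormedSpace ℝ E]
  {M : Type*} [TopologicalSpace M] [ChartedSpace E M] [IsManifold 𝓘(ℝ, E) ∞ M]
  {E' : Type*} [NormedAddCommGroup E'] [NormedSpace ℝ E']
  {N : Type*} [TopologicalSpace N] [ChartedSpace E' N] [IsManifold 𝓘(ℝ, E') ∞ N]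

/-- The map `F` in the preferred charts at `p` and `F p`. -/
noncomputable def chartMap (F : M → N) (p : M) (y : E) : E' :=
  extChartAt 𝓘(ℝ, E') (F p) (F ((extChartAt 𝓘(ℝ, E) p).symm y))

omit [IsManifold 𝓘(ℝ, E) ∞ M] [IsManifold 𝓘(ℝ, E') ∞ N] in
theorem chartMap_self (F : M → N) (p : M) :
    chartMap (E' := E') F p (extChartAt 𝓘(ℝ, E) p p) = extChartAt 𝓘(ℝ, E') (F p) (F p) := by
  rw [chartMap, extChartAt_to_inv]

omit [IsManifold 𝓘(ℝ, E) ∞ M] [IsManifold 𝓘(ℝ, E') ∞ N] in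
theorem contDiffAt_chartMap {F : M → N} (hF : ContMDiff 𝓘(ℝ, E) 𝓘(ℝ, E') ∞ F) (p : M) :
    ContDiffAt ℝ 2 (chartMap (E' := E') F p) (extChartAt 𝓘(ℝ, E) p p) := by
  have h := (contMDiffAt_iff.1 ((hF.of_le (m := 2) ENat.LEInfty.out) p)).2
  rwa [ModelWithCorners.range_eq_univ, contDiffWithinAt_univ] at h

/-- With `φ`, `ψ` the charts at `p`, `F p` and `f` the chart map, `ψ⁻¹ ∘ f = F ∘ φ⁻¹` near `y`; the
last clause is the chain rule for both sides. -/
theorem eventually_chartMap {F : M → N} (hF : ContMDiff 𝓘(ℝ, E) 𝓘(ℝ, E') ∞ F) (p : M) :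
    ∀ᶠ y in 𝓝 (extChartAt 𝓘(ℝ, E) p p), y ∈ (extChartAt 𝓘(ℝ, E) p).target ∧
      chartMap (E' := E') F p y ∈ (extChartAt 𝓘(ℝ, E') (F p)).target ∧
      (extChartAt 𝓘(ℝ, E') (F p)).symm (chartMap (E' := E') F p y) = F ((extChartAt 𝓘(ℝ, E) p).symm y) ∧
      ∀ w : E, (mfderiv 𝓘(ℝ, E') 𝓘(ℝ, E') (extChartAt 𝓘(ℝ, E') (F p)).symm (chartMap (E' := E') F p y)
          (fderiv ℝ (chartMap (E' := E') F p) y w) : E') =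
        mfderiv 𝓘(ℝ, E) 𝓘(ℝ, E') F ((extChartAt 𝓘(ℝ, E) p).symm y)
          (mfderiv 𝓘(ℝ, E) 𝓘(ℝ, E) (extChartAt 𝓘(ℝ, E) p).symm y w) := by
  have hcont : ContinuousAt (fun y ↦ F ((extChartAt 𝓘(ℝ, E) p).symm y))
      (extChartAt 𝓘(ℝ, E) p p) :=
    hF.continuous.continuousAt.comp (continuousAt_extChartAt_symm p)
  have h1 : ∀ᶠ y in 𝓝 (extChartAt 𝓘(ℝ, E) p p),
      F ((extChartAt 𝓘(ℝ, E) p).symm y) ∈ (extChartAt 𝓘(ℝ, E') (F p)).source := by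
    refine hcont.eventually_mem ?_
    rw [extChartAt_to_inv]
    exact extChartAt_source_mem_nhds (F p)
  have h2 : ∀ᶠ y in 𝓝 (extChartAt 𝓘(ℝ, E) p p), DifferentiableAt ℝ (chartMap (E' := E') F p) y := by
    filter_upwards [((contDiffAt_chartMap hF p).of_le (m := 1) (by norm_num)).eventually (by simp)]
      with y hy using hy.differentiableAt (by simp)
  filter_upwards [h1.eventually_nhds, extChartAt_target_mem_nhds (I := 𝓘(ℝ, E)) p, h2]
    with y hy1 hy2 hy3
  have ht : chartMap (E' := E') F p y ∈ (extChartAt 𝓘(ℝ, E') (F p)).target :=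
    (extChartAt 𝓘(ℝ, E') (F p)).map_source hy1.self_of_nhds
  have hcomp : (extChartAt 𝓘(ℝ, E') (F p)).symm ∘ chartMap (E' := E') F p
      =ᶠ[𝓝 y] F ∘ (extChartAt 𝓘(ℝ, E) p).symm := by
    filter_upwards [hy1] with z hz using (extChartAt 𝓘(ℝ, E') (F p)).left_inv hz
  refine ⟨hy2, ht, hcomp.self_of_nhds, fun w ↦ ?_⟩
  have dF : MDifferentiableAt 𝓘(ℝ, E) 𝓘(ℝ, E') F ((extChartAt 𝓘(ℝ, E) p).symm y) :=
    hF.mdifferentiable (by simp) _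
  have dφ : MDifferentiableAt 𝓘(ℝ, E) 𝓘(ℝ, E) (extChartAt 𝓘(ℝ, E) p).symm y :=
    mdifferentiableAt_extChartAt_symm hy2
  have dψ : MDifferentiableAt 𝓘(ℝ, E') 𝓘(ℝ, E') (extChartAt 𝓘(ℝ, E') (F p)).symm
      (chartMap (E' := E') F p y) := mdifferentiableAt_extChartAt_symm ht
  have e1 := (dψ.hasMFDerivAt.comp y hy3.hasFDerivAt.hasMFDerivAt).congr_of_eventuallyEq
    hcomp.symm
  exact congrArg (fun T ↦ T w)
    (hasMFDerivAt_unique e1 (dF.hasMFDerivAt.comp y dφ.hasMFDerivAt))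

theorem fderiv_chartMap_self {F : M → N} (hF : ContMDiff 𝓘(ℝ, E) 𝓘(ℝ, E') ∞ F) (p : M) (w : E) :
    (mfderiv 𝓘(ℝ, E) 𝓘(ℝ, E') F p w : E')
      = fderiv ℝ (chartMap (E' := E') F p) (extChartAt 𝓘(ℝ, E) p p) w := by
  have h := (eventually_chartMap hF p).self_of_nhds.2.2.2 w
  rw [mfderiv_extChartAt_symm_self, chartMap_self, mfderiv_extChartAt_symm_self,
    extChartAt_to_inv (I := 𝓘(ℝ, E)) p] at h
  exact h.symm

end ChartMap

section Hessian

variable {E : Type*} [NormedAddCommGroup E] [NormedSpace ℝ E]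
  {M : Type*} [TopologicalSpace M] [ChartedSpace E M]
  {E' : Type*} [NormedAddCommGroup E'] [NormedSpace ℝ E']
  {N : Type*} [TopologicalSpace N] [ChartedSpace E' N]

/-- The second derivative of `F` at `p` in the preferred charts at `p` and `F p`. -/
noncomputable def chartHessian (F : M → N) (p : M) (u v : TangentSpace 𝓘(ℝ, E) p) :
    TangentSpace 𝓘(ℝ, E') (F p) :=
  fderiv ℝ (fderiv ℝ (chartMap (E := E) (E' := E') F p)) (extChartAt 𝓘(ℝ, E) p p) u v

end Hessian

section SecondFundamentalForm

variable {E : Type*} [NormedAddCommGroup E] [NormedSpace ℝ E] [FiniteDimensional ℝ E]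
  {M : Type*} [TopologicalSpace M] [ChartedSpace E M] [IsManifold 𝓘(ℝ, E) ∞ M]
  [RiemannianBundle (fun p : M ↦ TangentSpace 𝓘(ℝ, E) p)]
  {E' : Type*} [NormedAddCommGroup E'] [NormedSpace ℝ E'] [FiniteDimensional ℝ E']
  {N : Type*} [TopologicalSpace N] [ChartedSpace E' N] [IsManifold 𝓘(ℝ, E') ∞ N]
  [RiemannianBundle (fun q : N ↦ TangentSpace 𝓘(ℝ, E') q)]

omit [IsManifold 𝓘(ℝ, E) ∞ M] in
theorem inner_christoffel (p : M) (u v w : TangentSpace 𝓘(ℝ, E) p) :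
    ⟪christoffel p u v, w⟫_ℝ = koszulForm (chartMetric p) (extChartAt 𝓘(ℝ, E) p p) u v w :=
  InnerProductSpace.toDual_symm_apply

/-- The second fundamental form in the preferred charts. -/
theorem secondFundamentalForm_eq {F : M → N} (hF : ContMDiff 𝓘(ℝ, E) 𝓘(ℝ, E') ∞ F) (p : M)
    (u v : TangentSpace 𝓘(ℝ, E) p) :
    secondFundamentalForm (E' := E') F p u v =
      chartHessian F p u v
      + christoffel (F p) (mfderiv 𝓘(ℝ, E) 𝓘(ℝ, E') F p u) (mfderiv 𝓘(ℝ, E) 𝓘(ℝ, E') F p v)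
      - mfderiv 𝓘(ℝ, E) 𝓘(ℝ, E') F p (christoffel p u v) := by
  have hd : DifferentiableAt ℝ (fderiv ℝ (chartMap (E := E) (E' := E') F p))
      (extChartAt 𝓘(ℝ, E) p p) :=
    ((contDiffAt_chartMap hF p).fderiv_right (m := 1)
      (by norm_num)).differentiableAt (by norm_num)
  have hdv : HasFDerivAt (fun y ↦ fderiv ℝ (chartMap (E := E) (E' := E') F p) y v)
      ((fderiv ℝ (fderiv ℝ (chartMap (E := E) (E' := E') F p)) (extChartAt 𝓘(ℝ, E) p p)).flip v)
      (extChartAt 𝓘(ℝ, E) p p) :=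
    hasFDerivAt_fderiv_apply hd v
  have hev : ∀ᶠ q in 𝓝 p, (mfderiv 𝓘(ℝ, E') 𝓘(ℝ, E') (extChartAt 𝓘(ℝ, E') (F p)) (F q)
      (mfderiv 𝓘(ℝ, E) 𝓘(ℝ, E') F q (FiberBundle.extend E v q)) : E')
        = fderiv ℝ (chartMap (E' := E') F p) (extChartAt 𝓘(ℝ, E) p q) v := by
    filter_upwards [(continuousAt_extChartAt (I := 𝓘(ℝ, E)) p).eventually
      (eventually_chartMap hF p), extChartAt_source_mem_nhds (I := 𝓘(ℝ, E)) p] with q hq hqs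
    obtain ⟨-, h2, h3, h4⟩ := hq
    have h5 := mfderiv_extChartAt_comp_symm h2 (fderiv ℝ (chartMap (E' := E') F p) (extChartAt 𝓘(ℝ, E) p q) v)
    rw [h3] at h5
    refine Eq.trans ?_ h5
    have h6 := h4 v
    rw [(extChartAt 𝓘(ℝ, E) p).left_inv hqs] at h6
    have h7 := congrArg (mfderiv 𝓘(ℝ, E) 𝓘(ℝ, E') F q) (extend_eq_mfderiv_symm hqs v)
    have h8 := congrArg (mfderiv 𝓘(ℝ, E') 𝓘(ℝ, E') (extChartAt 𝓘(ℝ, E') (F p)) (F q))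
      (h7.trans h6.symm)
    rw [(extChartAt 𝓘(ℝ, E) p).left_inv hqs]
    exact h8
  have h0 := mfderiv_apply_of_eventuallyEq_comp_extChartAt
    (E := E) (g := fun y ↦ fderiv ℝ (chartMap (E := E) (E' := E') F p) y v) hdv.differentiableAt hev u
  rw [hdv.fderiv] at h0
  simp only [secondFundamentalForm, pullbackCovDeriv, leviCivita_extend,
    FiberBundle.extend_apply_self]
  exact congrArg (fun e : TangentSpace 𝓘(ℝ, E') (F p) ↦ e
    + christoffel (F p) (mfderiv 𝓘(ℝ, E) 𝓘(ℝ, E') F p u) (mfderiv 𝓘(ℝ, E) 𝓘(ℝ, E') F p v)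
    - mfderiv 𝓘(ℝ, E) 𝓘(ℝ, E') F p (christoffel p u v)) h0

end SecondFundamentalForm

-- Smoothness of the dilation is not part of the definition of a horizontally conformal submersion;
-- it is recovered here. A functional `l` with `l a = 1` gives `L = l (f' P)` along the adjoint
-- field `P` of `a`; a nonzero `a` is needed, whence `Nontrivial E'`.
set_option synthInstance.maxHeartbeats 200000 in
theorem differentiableAt_of_horizontallyConformal {E : Type*} [NormedAddCommGroup E]
    [NormedSpace ℝ E] [FiniteDimensional ℝ E] {E' : Type*} [NormedAddCommGroup E']
    [NormedSpace ℝ E'] [Nontrivial E'] {G : E → E →L[ℝ] E →L[ℝ] ℝ}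
    {H : E' → E' →L[ℝ] E' →L[ℝ] ℝ} {f : E → E'} {L : E → ℝ} {y₀ : E}
    (hG : DifferentiableAt ℝ G y₀) (hH : DifferentiableAt ℝ H (f y₀))
    (hf : ContDiffAt ℝ 2 f y₀) (hinv : (G y₀).IsInvertible)
    (hconf : ∀ᶠ y in 𝓝 y₀, ∀ z a, (∀ w, G y z w = H (f y) a (fderiv ℝ f y w)) →
      fderiv ℝ f y z = L y • a) :
    DifferentiableAt ℝ L y₀ := by
  obtain ⟨a, ha⟩ := exists_ne (0 : E')
  obtain ⟨l, hl⟩ := SeparatingDual.exists_eq_one (R := ℝ) ha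
  obtain ⟨P, hP, hPe⟩ := exists_adjoint_field hG hH hf hinv a
  have hDf : DifferentiableAt ℝ (fderiv ℝ f) y₀ :=
    (hf.fderiv_right (m := 1) (by norm_num)).differentiableAt (by norm_num)
  have h := l.differentiableAt.comp y₀ (hDf.clm_apply hP)
  refine h.congr_of_eventuallyEq ?_
  filter_upwards [hconf, hPe] with y h1 h2
  simp [h1 _ _ h2, hl]

/-! ### Linear algebra of a conformal submersion. -/

section LinearAlgebra

variable {V W : Type*} [NormedAddCommGroup V] [InnerProductSpace ℝ V] [FiniteDimensional ℝ V]
  [NormedAddCommGroup W] [InnerProductSpace ℝ W] {T : V →L[ℝ] W} {c : ℝ}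

/-- For a conformal submersion `T` of inner product spaces, `T` composed with its adjoint is a
multiple of the identity. -/
theorem apply_eq_smul_of_conformal (hT : Function.Surjective T)
    (hc : ∀ x ∈ T.kerᗮ, ∀ y ∈ T.kerᗮ, ⟪T x, T y⟫_ℝ = c * ⟪x, y⟫_ℝ) {z : V} {a : W}
    (h : ∀ u, ⟪z, u⟫_ℝ = ⟪a, T u⟫_ℝ) : T z = c • a := by
  have hz : z ∈ T.kerᗮ := by
    rw [Submodule.mem_orthogonal']
    intro u hu
    have hu' : T u = 0 := LinearMap.mem_ker.1 hu
    -- The hypothesis `h` says `z = T* a`, and the image of an adjoint is orthogonal to the kernel.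
    rw [h, hu', inner_zero_right]
  refine ext_inner_right ℝ fun b ↦ ?_
  obtain ⟨u, rfl⟩ := hT b
  have hd : T (u - T.ker.starProjection u) = T u := by
    have h1 : T (T.ker.starProjection u) = 0 :=
      LinearMap.mem_ker.1 (T.ker.starProjection_apply_mem u)
    rw [map_sub, h1, sub_zero]
  rw [← hd, hc z hz _ (T.ker.sub_starProjection_mem_orthogonal u), h, inner_smul_left]
  rfl

theorem inner_eq_of_conformal
    (hc : ∀ x ∈ T.kerᗮ, ∀ y ∈ T.kerᗮ, ⟪T x, T y⟫_ℝ = c * ⟪x, y⟫_ℝ) {x : V} (hx : x ∈ T.kerᗮ)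
    (u : V) : ⟪T x, T u⟫_ℝ = c * ⟪x, u⟫_ℝ := by
  have h1 : T (T.ker.starProjection u) = 0 :=
    LinearMap.mem_ker.1 (T.ker.starProjection_apply_mem u)
  have hd : T (u - T.ker.starProjection u) = T u := by
    rw [map_sub, h1, sub_zero]
  rw [← hd, hc x hx _ (T.ker.sub_starProjection_mem_orthogonal u), inner_sub_right,
    Submodule.inner_left_of_mem_orthogonal (T.ker.starProjection_apply_mem u) hx, sub_zero]

end LinearAlgebra

theorem fderiv_sq_apply {V : Type*} [NormedAddCommGroup V] [NormedSpace ℝ V] {g : V → ℝ} {y : V}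
    (hg : DifferentiableAt ℝ g y) (u : V) :
    fderiv ℝ (fun z ↦ g z ^ 2) y u = 2 * g y * fderiv ℝ g y u := by
  rw [(hg.hasFDerivAt.pow 2).fderiv]
  simp

/-- The differential of a real function. -/
noncomputable def differential {E : Type*} [NormedAddCommGroup E] [NormedSpace ℝ E]
    {M : Type*} [TopologicalSpace M] [ChartedSpace E M] (f : M → ℝ) (p : M) :
    TangentSpace 𝓘(ℝ, E) p →L[ℝ] ℝ :=
  mfderiv 𝓘(ℝ, E) 𝓘(ℝ, ℝ) f p

/-! ### The second fundamental form on horizontal vectors in terms of the dilation. -/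

section Formula

variable {E : Type*} [NormedAddCommGroup E] [NormedSpace ℝ E] [FiniteDimensional ℝ E]
  {M : Type*} [TopologicalSpace M] [ChartedSpace E M] [IsManifold 𝓘(ℝ, E) ∞ M]
  [RiemannianBundle (fun p : M ↦ TangentSpace 𝓘(ℝ, E) p)]
  {E' : Type*} [NormedAddCommGroup E'] [NormedSpace ℝ E'] [FiniteDimensional ℝ E']
  {N : Type*} [TopologicalSpace N] [ChartedSpace E' N] [IsManifold 𝓘(ℝ, E') ∞ N]
  [RiemannianBundle (fun q : N ↦ TangentSpace 𝓘(ℝ, E') q)]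
  {F : M → N} {lam : M → ℝ}

/-- This is `T T* = λ²` carried to coordinates. Surjectivity of the differential of `φ⁻¹` lets
coordinate vectors test all tangent vectors of `M`; injectivity of that of `ψ⁻¹` brings the
conclusion back to `E'`. -/
theorem eventually_conformal_chartMap
    (hF : IsHorizontallyConformalSubmersion (E := E) (E' := E') F lam) (p : M) :
    ∀ᶠ y in 𝓝 (extChartAt 𝓘(ℝ, E) p p), ∀ (z : E) (a : E'),
      (∀ w, chartMetric p y z w = chartMetric (F p) (chartMap (E' := E') F p y) a
        (fderiv ℝ (chartMap (E' := E') F p) y w)) →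
      fderiv ℝ (chartMap (E' := E') F p) y z
        = (lam ((extChartAt 𝓘(ℝ, E) p).symm y)) ^ 2 • a := by
  filter_upwards [eventually_chartMap hF.smooth p] with y hy z a h
  obtain ⟨h1, h2, h3, h4⟩ := hy
  set q := (extChartAt 𝓘(ℝ, E) p).symm y
  have hA : Function.Surjective
      (mfderiv 𝓘(ℝ, E) 𝓘(ℝ, E) (extChartAt 𝓘(ℝ, E) p).symm y) := by
    obtain ⟨A, hA⟩ := isInvertible_mfderiv_extChartAt_symm h1
    rw [← hA]
    exact A.surjective
  have hC : Function.Injective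
      (mfderiv 𝓘(ℝ, E') 𝓘(ℝ, E') (extChartAt 𝓘(ℝ, E') (F p)).symm
        (chartMap (E' := E') F p y)) := by
    obtain ⟨C, hC⟩ := isInvertible_mfderiv_extChartAt_symm h2
    rw [← hC]
    exact C.injective
  have key : ∀ u : TangentSpace 𝓘(ℝ, E) q,
      inner ℝ (E := TangentSpace 𝓘(ℝ, E) q)
          (mfderiv 𝓘(ℝ, E) 𝓘(ℝ, E) (extChartAt 𝓘(ℝ, E) p).symm y z) u
        = inner ℝ (E := TangentSpace 𝓘(ℝ, E') (F q))
          (mfderiv 𝓘(ℝ, E') 𝓘(ℝ, E') (extChartAt 𝓘(ℝ, E') (F p)).symm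
            (chartMap (E' := E') F p y) a)
          (mfderiv 𝓘(ℝ, E) 𝓘(ℝ, E') F q u) := by
    intro u
    obtain ⟨w, rfl⟩ := hA u
    exact (h w).trans ((inner_congr_point h3 _ _).trans
      (congrArg (fun t ↦ inner ℝ (E := TangentSpace 𝓘(ℝ, E') (F q))
        (mfderiv 𝓘(ℝ, E') 𝓘(ℝ, E') (extChartAt 𝓘(ℝ, E') (F p)).symm
          (chartMap (E' := E') F p y) a) t) (h4 w)))
  have h6 := apply_eq_smul_of_conformal (hF.surjective q) (hF.inner_eq q) key
  exact hC (((h4 z).trans h6).trans (map_smul _ _ a).symm)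

variable [IsContMDiffRiemannianBundle 𝓘(ℝ, E) ∞ E (fun p : M ↦ TangentSpace 𝓘(ℝ, E) p)]
  [IsContMDiffRiemannianBundle 𝓘(ℝ, E') ∞ E' (fun q : N ↦ TangentSpace 𝓘(ℝ, E') q)]

theorem differentiableAt_sq_dilation [Nontrivial E']
    (hF : IsHorizontallyConformalSubmersion (E := E) (E' := E') F lam) (p : M) :
    DifferentiableAt ℝ (fun y ↦ lam ((extChartAt 𝓘(ℝ, E) p).symm y) ^ 2)
      (extChartAt 𝓘(ℝ, E) p p) :=
  differentiableAt_of_horizontallyConformal (differentiableAt_chartMetric p)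
    (H := chartMetric (F p))
    (by rw [chartMap_self]; exact differentiableAt_chartMetric (F p))
    (contDiffAt_chartMap hF.smooth p) (isInvertible_chartMetric_self p)
    (eventually_conformal_chartMap hF p)

theorem fderiv_sq_dilation [Nontrivial E']
    (hF : IsHorizontallyConformalSubmersion (E := E) (E' := E') F lam) (p : M)
    (u : TangentSpace 𝓘(ℝ, E) p) :
    fderiv ℝ (fun y ↦ lam ((extChartAt 𝓘(ℝ, E) p).symm y) ^ 2) (extChartAt 𝓘(ℝ, E) p p) u
      = 2 * lam p * differential lam p u := by
  -- The dilation is the square root of a positive differentiable function.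
  have hd : DifferentiableAt ℝ (fun y ↦ lam ((extChartAt 𝓘(ℝ, E) p).symm y))
      (extChartAt 𝓘(ℝ, E) p p) := by
    have h := (differentiableAt_sq_dilation hF p).sqrt (pow_ne_zero 2 (hF.pos _).ne')
    simpa only [Real.sqrt_sq (hF.pos _).le] using h
  have hev : lam =ᶠ[𝓝 p] fun q ↦
      lam ((extChartAt 𝓘(ℝ, E) p).symm (extChartAt 𝓘(ℝ, E) p q)) := by
    filter_upwards [extChartAt_source_mem_nhds (I := 𝓘(ℝ, E)) p] with q hq
    rw [(extChartAt 𝓘(ℝ, E) p).left_inv hq]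
  have h1 := mfderiv_apply_of_eventuallyEq_comp_extChartAt
    (g := fun y ↦ lam ((extChartAt 𝓘(ℝ, E) p).symm y)) hd hev u
  refine (fderiv_sq_apply hd u).trans ?_
  rw [extChartAt_to_inv (I := 𝓘(ℝ, E)) p]
  exact congrArg (fun t : ℝ ↦ 2 * lam p * t) h1.symm

/-- The second fundamental form of a horizontally conformal submersion on horizontal vectors. -/
theorem inner_secondFundamentalForm
    (hF : IsHorizontallyConformalSubmersion (E := E) (E' := E') F lam) (p : M)
    {x y z : TangentSpace 𝓘(ℝ, E) p} (hx : x ∈ horiz (E' := E') F p)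
    (hy : y ∈ horiz (E' := E') F p) (hz : z ∈ horiz (E' := E') F p) :
    ⟪secondFundamentalForm (E' := E') F p x y, mfderiv 𝓘(ℝ, E) 𝓘(ℝ, E') F p z⟫_ℝ
      = lam p * (differential lam p x * ⟪y, z⟫_ℝ
        + differential lam p y * ⟪x, z⟫_ℝ
        - differential lam p z * ⟪x, y⟫_ℝ) := by
  set T := mfderiv 𝓘(ℝ, E) 𝓘(ℝ, E') F p
  have hT : ∀ {u : TangentSpace 𝓘(ℝ, E) p}, u ∈ horiz (E' := E') F p →
      ∀ w, ⟪T u, T w⟫_ℝ = lam p ^ 2 * ⟪u, w⟫_ℝ :=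
    fun hu w ↦ inner_eq_of_conformal (hF.inner_eq p) hu w
  have hpos := hF.pos p
  -- If `E'` is zero, differentiability of the dilation is unavailable, but conformality makes every
  -- horizontal vector null and both sides vanish.
  rcases subsingleton_or_nontrivial E' with hE' | hE'
  · have hsub : ∀ w : TangentSpace 𝓘(ℝ, E') (F p), w = 0 := fun w ↦ hE'.elim _ _
    have h0 : ∀ {u : TangentSpace 𝓘(ℝ, E) p}, u ∈ horiz (E' := E') F p →
      ∀ w, ⟪u, w⟫_ℝ = 0 := by
      intro u hu w
      have h := hT hu w
      rw [hsub (T u), inner_zero_left] at h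
      exact (mul_eq_zero.1 h.symm).resolve_left (pow_pos hpos 2).ne'
    rw [hsub (T z), inner_zero_right, h0 hy, h0 hx, h0 hx]
    ring
  -- A horizontal `u` is `T* (λ⁻² T u)`; these vectors play the roles of `a`, `b`, `c` in the
  -- coordinate formula.
  have hadj : ∀ {u : TangentSpace 𝓘(ℝ, E) p}, u ∈ horiz (E' := E') F p → ∀ w,
      ⟪u, w⟫_ℝ = ⟪(lam p ^ 2)⁻¹ • T u, T w⟫_ℝ := by
    intro u hu w
    rw [real_inner_smul_left, hT hu, inv_mul_cancel_left₀ (pow_pos hpos 2).ne']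
  have hH : ∀ v w : E',
      chartMetric (F p) (chartMap (E' := E') F p (extChartAt 𝓘(ℝ, E) p p)) v w
        = inner ℝ (E := TangentSpace 𝓘(ℝ, E') (F p)) v w := by
    intro v w
    rw [chartMap_self]
    exact chartMetric_self (F p) v w
  have hchart : ∀ {u : TangentSpace 𝓘(ℝ, E) p}, u ∈ horiz (E' := E') F p → ∀ w : E,
      chartMetric p (extChartAt 𝓘(ℝ, E) p p) u w
        = chartMetric (F p) (chartMap (E' := E') F p (extChartAt 𝓘(ℝ, E) p p))
          ((lam p ^ 2)⁻¹ • T u)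
          (fderiv ℝ (chartMap (E' := E') F p) (extChartAt 𝓘(ℝ, E) p p) w) := by
    intro u hu w
    refine (chartMetric_self (E := E) p u w).trans ((hadj hu w).trans (Eq.trans ?_ (hH _ _).symm))
    exact congrArg (fun t : E' ↦ inner ℝ (E := TangentSpace 𝓘(ℝ, E') (F p))
      ((lam p ^ 2)⁻¹ • T u) t) (fderiv_chartMap_self hF.smooth p w)
  have hdH : DifferentiableAt ℝ (chartMetric (F p))
      (chartMap (E' := E') F p (extChartAt 𝓘(ℝ, E) p p)) := by
    rw [chartMap_self]
    exact differentiableAt_chartMetric (F p)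
  have key := koszulForm_horizontallyConformal (E := E) (E' := E') (differentiableAt_chartMetric p)
    (H := chartMetric (F p))
    hdH
    (contDiffAt_chartMap hF.smooth p) (differentiableAt_sq_dilation (E := E) hF p)
    (isInvertible_chartMetric_self p) (chartMetric_comm p _) (chartMetric_comm (F p) _)
    (eventually_conformal_chartMap hF p) (hchart hx) (hchart hy) (hchart hz)
  set c := (lam p ^ 2)⁻¹ • T z with hc
  have e2 : ⟪christoffel (F p) (T x) (T y), c⟫_ℝ = koszulForm (chartMetric (F p))
      (chartMap (E' := E') F p (extChartAt 𝓘(ℝ, E) p p))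
      (fderiv ℝ (chartMap (E' := E') F p) (extChartAt 𝓘(ℝ, E) p p) x)
      (fderiv ℝ (chartMap (E' := E') F p) (extChartAt 𝓘(ℝ, E) p p) y) c := by
    rw [chartMap_self]
    exact (inner_christoffel (F p) (T x) (T y) c).trans (congrArg₂
      (fun a b : E' ↦ koszulForm (chartMetric (F p)) (extChartAt 𝓘(ℝ, E') (F p) (F p)) a b c)
      (fderiv_chartMap_self hF.smooth p x) (fderiv_chartMap_self hF.smooth p y))
  have e3 : ⟪T (christoffel p x y), c⟫_ℝ = _ :=
    (real_inner_comm _ _).trans ((hadj hz _).symm.trans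
      ((real_inner_comm _ _).trans (inner_christoffel p x y z)))
  have e1 : ⟪chartHessian F p x y, c⟫_ℝ = _ := (hH _ _).symm
  have aux : ∀ {a b d i j k i' j' k' : ℝ}, i = i' → j = j' → k = k' →
      (a * i + b * j - d * k) / 2 = (a * i' + b * j' - d * k') / 2 := by
    rintro a b d i j k _ _ _ rfl rfl rfl
    rfl
  have e4 : ⟪secondFundamentalForm (E' := E') F p x y, c⟫_ℝ
      = (2 * lam p * differential lam p x * ⟪(lam p ^ 2)⁻¹ • T y, c⟫_ℝ
        + 2 * lam p * differential lam p y * ⟪(lam p ^ 2)⁻¹ • T x, c⟫_ℝ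
        - 2 * lam p * differential lam p z * ⟪(lam p ^ 2)⁻¹ • T x, (lam p ^ 2)⁻¹ • T y⟫_ℝ) / 2 := by
    rw [secondFundamentalForm_eq hF.smooth, inner_sub_left, inner_add_left, e1, e2, e3,
      ← fderiv_sq_dilation hF p x, ← fderiv_sq_dilation hF p y, ← fderiv_sq_dilation hF p z]
    exact key.trans (aux (hH _ _) (hH _ _) (hH _ _))
  simp only [hc, real_inner_smul_left, real_inner_smul_right, hT hy, hT hx] at e4
  have hne := hpos.ne'
  field_simp at e4
  linear_combination e4

end Formula

/-- By Pythagoras, the projection to `W` has full norm exactly when the normal component vanishes.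
For `R v` and the vertical space, that component is `ω_R v`. -/
theorem angleToSubspace_eq_zero_iff {V : Type*} [NormedAddCommGroup V] [InnerProductSpace ℝ V]
    {x : V} (hx : x ≠ 0) (W : Submodule ℝ V) [W.HasOrthogonalProjection] :
    angleToSubspace x W = 0 ↔ Wᗮ.starProjection x = 0 := by
  have hx' : 0 < ‖x‖ := norm_pos_iff.2 hx
  have h := W.norm_sq_eq_add_norm_sq_starProjection x
  rw [angleToSubspace, Real.arccos_eq_zero, one_le_div hx']
  constructor
  · intro hle
    have : ‖Wᗮ.starProjection x‖ ^ 2 ≤ 0 := by nlinarith [norm_nonneg x]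
    exact norm_eq_zero.1 (pow_eq_zero_iff two_ne_zero |>.1 (le_antisymm this (sq_nonneg _)))
  · intro h0
    rw [h0, norm_zero] at h
    exact (pow_le_pow_iff_left₀ hx'.le (norm_nonneg _) two_ne_zero).1 (by linarith)

/-! ### Ranks of the slant distributions. -/

section Slant

variable {E : Type*} [NormedAddCommGroup E] [NormedSpace ℝ E] [FiniteDimensional ℝ E]
  {M : Type*} [TopologicalSpace M] [ChartedSpace E M]
  [RiemannianBundle (fun p : M ↦ TangentSpace 𝓘(ℝ, E) p)]
  {E' : Type*} [NormedAddCommGroup E'] [NormedSpace ℝ E']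
  {N : Type*} [TopologicalSpace N] [ChartedSpace E' N]
  {F : M → N} {R : Π p : M, TangentSpace 𝓘(ℝ, E) p →L[ℝ] TangentSpace 𝓘(ℝ, E) p}

theorem omega_mem_horiz (p : M) (v : TangentSpace 𝓘(ℝ, E) p) :
    omega (E := E) (E' := E') F R p v ∈ horiz (E := E) (E' := E') F p :=
  Submodule.starProjection_apply_mem (Submodule.orthogonal (vert (E := E) (E' := E') F p)) (R p v)

theorem omegaVert_le_horiz (p : M) : omegaVert (E := E) (E' := E') F R p ≤ horiz (E := E) (E' := E') F p := by
  rintro _ ⟨v, -, rfl⟩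
  exact omega_mem_horiz p v

omit [RiemannianBundle (fun p : M ↦ TangentSpace 𝓘(ℝ, E) p)] in
theorem finrank_vert (hF : ∀ p, Function.Surjective (mfderiv 𝓘(ℝ, E) 𝓘(ℝ, E') F p)) (p : M) :
    Module.finrank ℝ E' + Module.finrank ℝ (vert (E := E) (E' := E') F p) = Module.finrank ℝ E := by
  have h := (mfderiv 𝓘(ℝ, E) 𝓘(ℝ, E') F p).toLinearMap.finrank_range_add_finrank_ker
  rw [LinearMap.range_eq_top.2 (hF p), finrank_top] at h
  exact h

theorem finrank_vert_add_finrank_horiz (p : M) :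
    Module.finrank ℝ (vert (E := E) (E' := E') F p) + Module.finrank ℝ (horiz (E := E) (E' := E') F p)
      = Module.finrank ℝ E :=
  (vert (E := E) (E' := E') F p).finrank_add_finrank_orthogonal

theorem finrank_omegaVert_add_finrank_mu (p : M) :
    Module.finrank ℝ (omegaVert (E := E) (E' := E') F R p) + Module.finrank ℝ (mu (E := E) (E' := E') F R p)
      = Module.finrank ℝ (horiz (E := E) (E' := E') F p) := by
  rw [mu, inf_comm]
  exact Submodule.finrank_add_inf_finrank_orthogonal (omegaVert_le_horiz p)

theorem inner_eq_zero_of_mem_omegaVert_of_mem_mu {p : M} {x y : TangentSpace 𝓘(ℝ, E) p}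
    (hx : x ∈ omegaVert (E := E) (E' := E') F R p) (hy : y ∈ mu (E := E) (E' := E') F R p) : ⟪x, y⟫_ℝ = 0 :=
  Submodule.inner_right_of_mem_orthogonal hx hy.2

/-- If a slant distribution is not invariant at some point, then `ω_R` is injective on the vertical
space at every point. -/
theorem finrank_omegaVert (hR : ∀ p, Function.Injective (R p)) {θ : ℝ}
    (hθ : ∀ p, ∀ x ∈ vert (E := E) (E' := E') F p, x ≠ 0 →
      angleToSubspace (R p x) (vert (E := E) (E' := E') F p) = θ)
    {p₀ : M} (hp₀ : omegaVert (E := E) (E' := E') F R p₀ ≠ ⊥) (p : M) :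
    Module.finrank ℝ (omegaVert (E := E) (E' := E') F R p)
      = Module.finrank ℝ (vert (E := E) (E' := E') F p) := by
  have hR0 : ∀ {q} {v : TangentSpace 𝓘(ℝ, E) q}, v ≠ 0 → R q v ≠ 0 :=
    fun hv ↦ (map_ne_zero_iff _ (hR _)).2 hv
  -- Angle zero would make `ω_R` vanish on the vertical space at `p₀`. Conversely, a nonzero
  -- vertical vector killed by `ω_R` at any point would force `θ = 0`.
  have hθ0 : θ ≠ 0 := by
    rintro rfl
    refine hp₀ ((Submodule.eq_bot_iff _).2 ?_)
    rintro _ ⟨v, hv, rfl⟩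
    by_cases h0 : v = 0
    · rw [h0]
      exact map_zero _
    · exact (angleToSubspace_eq_zero_iff (hR0 h0) _).1 (hθ p₀ v hv h0)
  have hrange : omegaVert (E := E) (E' := E') F R p = LinearMap.range
      ((omega (E := E) (E' := E') F R p).toLinearMap.domRestrict (vert (E := E) (E' := E') F p)) :=
    (LinearMap.range_domRestrict _ _).symm
  rw [hrange]
  refine LinearMap.finrank_range_of_inj ((injective_iff_map_eq_zero _).2 fun v hv ↦ ?_)
  by_contra h0
  have h1 : (v : TangentSpace 𝓘(ℝ, E) p) ≠ 0 := fun h ↦ h0 (Subtype.ext h)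
  exact hθ0 ((hθ p v v.2 h1).symm.trans ((angleToSubspace_eq_zero_iff (hR0 h1) _).2 hv))

end Slant

/-! ### The two implications. -/

section Main
variable {E : Type*} [NormedAddCommGroup E] [NormedSpace ℝ E] [FiniteDimensional ℝ E]
  {M : Type*} [TopologicalSpace M] [ChartedSpace E M] [IsManifold 𝓘(ℝ, E) ∞ M]
  [RiemannianBundle (fun p : M ↦ TangentSpace 𝓘(ℝ, E) p)]
  [IsContMDiffRiemannianBundle 𝓘(ℝ, E) ∞ E (fun p : M ↦ TangentSpace 𝓘(ℝ, E) p)]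
  {E' : Type*} [NormedAddCommGroup E'] [NormedSpace ℝ E'] [FiniteDimensional ℝ E']
  {N : Type*} [TopologicalSpace N] [ChartedSpace E' N] [IsManifold 𝓘(ℝ, E') ∞ N]
  [RiemannianBundle (fun q : N ↦ TangentSpace 𝓘(ℝ, E') q)]
  [IsContMDiffRiemannianBundle 𝓘(ℝ, E') ∞ E' (fun q : N ↦ TangentSpace 𝓘(ℝ, E') q)]
  {F : M → N} {lam : M → ℝ}
  {R : Π p : M, TangentSpace 𝓘(ℝ, E) p →L[ℝ] TangentSpace 𝓘(ℝ, E) p}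

theorem isOmegaMuTotallyGeodesic_of_isHorizontallyHomothetic
    (hF : IsHorizontallyConformalSubmersion (E := E) (E' := E') F lam)
    (h : IsHorizontallyHomothetic (E := E) (E' := E') F lam) :
    IsOmegaMuTotallyGeodesic (E' := E') F R := by
  intro p v hv x hx
  have hd : ∀ u ∈ horiz (E := E) (E' := E') F p, differential lam p u = 0 := h p
  have hω : omega (E := E) (E' := E') F R p v ∈ omegaVert (E := E) (E' := E') F R p := ⟨v, hv, rfl⟩
  refine ext_inner_right ℝ fun b ↦ ?_
  -- Subtracting the vertical part of `u` leaves its image unchanged, so horizontal vectors suffice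
  -- to test the second fundamental form.
  obtain ⟨u, rfl⟩ := hF.surjective p b
  set V := vert (E := E) (E' := E') F p
  have h1 : mfderiv 𝓘(ℝ, E) 𝓘(ℝ, E') F p (V.starProjection u) = 0 :=
    LinearMap.mem_ker.1 (V.starProjection_apply_mem u)
  have hu : u - V.starProjection u ∈ horiz (E := E) (E' := E') F p :=
    V.sub_starProjection_mem_orthogonal u
  have h2 := inner_secondFundamentalForm hF p (omegaVert_le_horiz p hω) hx.1 hu
  rw [map_sub, h1, sub_zero, hd _ (omegaVert_le_horiz p hω), hd _ hx.1, hd _ hu] at h2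
  rw [h2, inner_zero_left]
  ring

/-- Each distribution is used to test the other: a nonzero `y` in `μ^R` shows that `dλ` vanishes on
`ω_R (ker F_*)`, and a nonzero `x` there shows that it vanishes on `μ^R`. Both must therefore be
nonzero at every point. -/
theorem isHorizontallyHomothetic_of_isOmegaMuTotallyGeodesic
    (hF : IsHorizontallyConformalSubmersion (E := E) (E' := E') F lam)
    (hω : ∀ p, omegaVert (E := E) (E' := E') F R p ≠ ⊥) (hμ : ∀ p, mu (E := E) (E' := E') F R p ≠ ⊥)
    (h : IsOmegaMuTotallyGeodesic (E' := E') F R) :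
    IsHorizontallyHomothetic (E := E) (E' := E') F lam := by
  intro p u hu
  obtain ⟨x, hx, hx0⟩ := Submodule.exists_mem_ne_zero_of_ne_bot (hω p)
  obtain ⟨y, hy, hy0⟩ := Submodule.exists_mem_ne_zero_of_ne_bot (hμ p)
  have hsff : ∀ {a b : TangentSpace 𝓘(ℝ, E) p}, a ∈ omegaVert (E := E) (E' := E') F R p →
      b ∈ mu (E := E) (E' := E') F R p → secondFundamentalForm (E' := E') F p a b = 0 := by
    rintro _ b ⟨v, hv, rfl⟩ hb
    exact h p v hv b hb
  have hpos := hF.pos p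
  have h1 : ∀ {a}, a ∈ omegaVert (E := E) (E' := E') F R p → differential lam p a = 0 := by
    intro a ha
    have h2 := inner_secondFundamentalForm hF p (omegaVert_le_horiz p ha) hy.1 hy.1
    rw [hsff ha hy, inner_zero_left, inner_eq_zero_of_mem_omegaVert_of_mem_mu ha hy] at h2
    have hyy : ⟪y, y⟫_ℝ ≠ 0 := inner_self_ne_zero.2 hy0
    simpa only [mul_zero, add_zero, sub_zero, zero_eq_mul, mul_eq_zero, hpos.ne', hyy,
      false_or, or_false] using h2
  have h2 : ∀ {b}, b ∈ mu (E := E) (E' := E') F R p → differential lam p b = 0 := by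
    intro b hb
    have h2 := inner_secondFundamentalForm hF p (omegaVert_le_horiz p hx) hb.1
      (omegaVert_le_horiz p hx)
    have h3 := inner_eq_zero_of_mem_omegaVert_of_mem_mu hx hb
    rw [hsff hx hb, inner_zero_left, h3, real_inner_comm, h3] at h2
    have hxx : ⟪x, x⟫_ℝ ≠ 0 := inner_self_ne_zero.2 hx0
    simpa only [mul_zero, zero_add, add_zero, sub_zero, zero_eq_mul, mul_eq_zero, hpos.ne', hxx, false_or,
      or_false] using h2
  set W := omegaVert (E := E) (E' := E') F R p
  have hu1 : W.starProjection u ∈ W := W.starProjection_apply_mem u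
  have hu2 : u - W.starProjection u ∈ mu (E := E) (E' := E') F R p :=
    ⟨sub_mem hu (omegaVert_le_horiz p hu1), W.sub_starProjection_mem_orthogonal u⟩
  have h3 := h2 hu2
  rw [map_sub, h1 hu1, sub_zero] at h3
  exact h3

end Main

end SlantSubmersion

open SlantSubmersion in
theorem theorem3p17
    {E : Type*} [NormedAddCommGroup E] [NormedSpace ℝ E] [FiniteDimensional ℝ E]
    {M : Type*} [TopologicalSpace M] [ChartedSpace E M] [IsManifold 𝓘(ℝ, E) ∞ M]
    [RiemannianBundle (fun p : M ↦ TangentSpace 𝓘(ℝ, E) p)]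
    [IsContMDiffRiemannianBundle 𝓘(ℝ, E) ∞ E (fun p : M ↦ TangentSpace 𝓘(ℝ, E) p)]
    {E' : Type*} [NormedAddCommGroup E'] [NormedSpace ℝ E'] [FiniteDimensional ℝ E']
    {N : Type*} [TopologicalSpace N] [ChartedSpace E' N] [IsManifold 𝓘(ℝ, E') ∞ N]
    [RiemannianBundle (fun q : N ↦ TangentSpace 𝓘(ℝ, E') q)]
    [IsContMDiffRiemannianBundle 𝓘(ℝ, E') ∞ E' (fun q : N ↦ TangentSpace 𝓘(ℝ, E') q)]
    (I J K : Π p : M, TangentSpace 𝓘(ℝ, E) p →L[ℝ] TangentSpace 𝓘(ℝ, E) p)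
    (hIJK : IsHyperkaehler I J K)
    (F : M → N) (lam : M → ℝ)
    (hF : IsHorizontallyConformalSubmersion (E := E) (E' := E') F lam)
    (hslant : IsAlmostHConformalSlantBasis (E' := E') F I J K) :
    (∀ R ∈ ({I, J, K} : Set (Π p : M, TangentSpace 𝓘(ℝ, E) p →L[ℝ] TangentSpace 𝓘(ℝ, E) p)),
      (∃ p, omegaVert (E' := E') F R p ≠ ⊥) → (∃ p, mu (E' := E') F R p ≠ ⊥) →
        (IsHorizontallyHomothetic (E := E) (E' := E') F lam ↔
          IsOmegaMuTotallyGeodesic (E' := E') F R)) ∧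
    (IsHorizontallyHomothetic (E := E) (E' := E') F lam →
      ∀ R ∈ ({I, J, K} : Set (Π p : M, TangentSpace 𝓘(ℝ, E) p →L[ℝ] TangentSpace 𝓘(ℝ, E) p)),
        IsOmegaMuTotallyGeodesic (E' := E') F R) := by
  have hfwd : IsHorizontallyHomothetic (E := E) (E' := E') F lam →
      ∀ R : Π p : M, TangentSpace 𝓘(ℝ, E) p →L[ℝ] TangentSpace 𝓘(ℝ, E) p,
        IsOmegaMuTotallyGeodesic (E' := E') F R :=
    fun h R ↦ isOmegaMuTotallyGeodesic_of_isHorizontallyHomothetic hF h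
  refine ⟨fun R hR ⟨p₀, hp₀⟩ ⟨q₀, hq₀⟩ ↦ ⟨fun h ↦ hfwd h R, fun h ↦ ?_⟩, fun h R _ ↦ hfwd h R⟩
  -- Injectivity follows from `R² = -id`.
  have hinj : ∀ p, Function.Injective (R p) := by
    intro p v w hvw
    have hv := hIJK.sq R hR p v
    rw [hvw, hIJK.sq R hR p w] at hv
    exact (neg_injective hv).symm
  obtain ⟨θ, hθ⟩ := hslant R hR
  have hdim := finrank_omegaVert hinj hθ hp₀
  have hvert := finrank_vert (E := E) (E' := E') hF.surjective
  have hne : ∀ {p : M} {W : Submodule ℝ (TangentSpace 𝓘(ℝ, E) p)},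
      W ≠ ⊥ ↔ Module.finrank ℝ W ≠ 0 := fun {p W} ↦ (Submodule.finrank_eq_zero (S := W)).not.symm
  rw [hne] at hp₀ hq₀
  refine isHorizontallyHomothetic_of_isOmegaMuTotallyGeodesic hF (fun p ↦ hne.2 ?_)
    (fun p ↦ hne.2 ?_) h
  -- The rank of `ω_R (ker F_*)` is `dim E - dim E'` at every point.
  · have h1 := hdim p
    have h2 := hdim p₀
    have h3 := hvert p
    have h4 := hvert p₀
    omega
  -- The rank of `μ^R` is `dim E' - (dim E - dim E')` at every point, so it can be read off at `q₀`.
  · have h1 := hdim p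
    have h2 := hdim q₀
    have h3 := hvert p
    have h4 := hvert q₀
    have h5 := finrank_omegaVert_add_finrank_mu (E' := E') (E := E) (F := F) (R := R) p
    have h6 := finrank_omegaVert_add_finrank_mu (E' := E') (E := E) (F := F) (R := R) q₀
    have h7 := finrank_vert_add_finrank_horiz (E' := E') (E := E) (F := F) p
    have h8 := finrank_vert_add_finrank_horiz (E' := E') (E := E) (F := F) q₀
    omega
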